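/- Let $L/K$ be a finite separable extension of fields. A Hopf algebra giving a Hopf–Galois structure on $L/K$ is a finite-dimensional cocommutative $K$-Hopf algebra $H$ together with a $K$-linear $H$-module algebra structure on $L$ such that the $K$-linear map $L\otimes_K H\to \mathrm{End}_K(L)$, $s\otimes h\mapsto (t\mapsto s\,(h\cdot t))$, is bijective. Let $H_1,H_2$ be two Hopf algebras giving Hopf–Galois structures on $L/K$ whose actions commute, i.e. $h_1\cdot(h_2\cdot x)=h_2\cdot(h_1\cdot x)$ for all $h_1\in H_1$, $h_2\in H_2$, $x\in L$. Assume that $K$ (hence $L$) is a non-archimedean local field or a global field, of any characteristic. Let $\mathfrak O_K$ be the ring of integers of $K$: the integral closure of $\mathbb Z$ in $K$ if $K$ is a number field; the valuation ring if $K$ is local; the integral closure in $K$ of $\mathbb F_q[t]$, for a choice of finite field $\mathbb F_q$ and of an embedding $\mathbb F_q(t)\subseteq K$ of finite degree, if $K$ is a global function field. Let $\mathfrak O_L$ be the integral closure of $\mathfrak O_K$ in $L$, and let $\mathfrak B$ be a fractional ideal of $L$, i.e. of $\mathfrak O_L$. For $i=1,2$ let $\mathfrak A_i=\{h\in H_i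 \mid h\cdot b\in\mathfrak B \text{ for all } b\in\mathfrak B\}$ be the associated order of $\mathfrak B$ in $H_i$. Then $\mathfrak B$ is a free $\mathfrak A_1$-module if and only if it is a free $\mathfrak A_2$-module. Moreover, suppose that $x\in\mathfrak B$ generates $\mathfrak B$ freely over $\mathfrak A_1$, i.e. every $b\in\mathfrak B$ can be written as $b=a\cdot x$ for a unique $a\in\mathfrak A_1$. Then for every $a\in\mathfrak A_1$ there is a unique $z_a\in H_2$ with $z_a\cdot x=a\cdot x$, and $\mathfrak A_2=\{z_a\mid a\in\mathfrak A_1\}$. -/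

import Mathlib

open scoped TensorProduct nonZeroDivisors

/-- `R` is a ring of integers `𝔒_K` of the local or global field `K`, in one of three cases:
`K` is a number field and `R` is the integral closure of `ℤ` in `K`; `K` is a global function
field, i.e. a finite extension of `F(t)` for a finite field `F`, and `R` is the integral closure
of `F[t]` in `K`; `K` is a non-archimedean local field (of any characteristic) and `R` is its
valuation ring. -/
def IsRingOfIntegers {K : Type*} [Field K] (R : Subring K) : Prop :=
  (NumberField K ∧ R = (integralClosure ℤ K).toSubring) ∨
  (∃ (F : Type) (_ : Field F) (_ : Finite F) (_ : Algebra (Polynomial F) K)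
      (_ : Algebra (RatFunc F) K) (_ : IsScalarTower (Polynomial F) (RatFunc F) K),
      FunctionField F K ∧ R = (FunctionField.ringOfIntegers F K).toSubring) ∨
  (∃ (_ : ValuativeRel K) (_ : TopologicalSpace K),
      IsNonarchimedeanLocalField K ∧ R = (ValuativeRel.valuation K).integer)

/-- The canonical `K`-linear map `j : L ⊗[K] H → End_K(L)`, `j(s ⊗ h)(t) = s * (h • t)`. -/
noncomputable def hopfGaloisMap (K H L : Type*) [Field K] [Ring H] [Algebra K H]
    [Field L] [Algebra K L] [Module H L] [IsScalarTower K H L] :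
    L ⊗[K] H →ₗ[K] Module.End K L :=
  TensorProduct.lift
    ((LinearMap.mul K (Module.End K L)).compl₁₂
      (Algebra.lmul K L).toLinearMap (Algebra.lsmul K K L (A := H)).toLinearMap)

theorem hopfGaloisMap_tmul_apply (K H L : Type*) [Field K] [Ring H] [Algebra K H]
    [Field L] [Algebra K L] [Module H L] [IsScalarTower K H L] (s t : L) (h : H) :
    hopfGaloisMap K H L (s ⊗ₜ[K] h) t = s * (h • t) := by
  simp [hopfGaloisMap]

/-- The finite-dimensional cocommutative `K`-Hopf algebra `H`, acting `K`-linearly on the field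
`L`, gives a Hopf-Galois structure on `L/K`: `L` is an `H`-module algebra and the map
`j : L ⊗[K] H → End_K(L)` is bijective. -/
class IsHopfGalois (K H L : Type*) [Field K] [Ring H] [HopfAlgebra K H]
    [Field L] [Algebra K L] [Module H L] [IsScalarTower K H L] : Prop where
  finite : Module.Finite K H
  cocomm : Coalgebra.IsCocomm K H
  /-- `h • (s * t) = ∑ (h₍₁₎ • s) * (h₍₂₎ • t)`, where `∑ h₍₁₎ ⊗ h₍₂₎` is the comultiplication
  of `h` and `(Algebra.lsmul K K L).toLinearMap.flip s` is the `K`-linear map `h ↦ h • s`. -/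
  smul_mul : ∀ (h : H) (s t : L), h • (s * t) =
    LinearMap.mul' K L
      (TensorProduct.map ((Algebra.lsmul K K L (A := H)).toLinearMap.flip s)
        ((Algebra.lsmul K K L (A := H)).toLinearMap.flip t) (Coalgebra.comul (R := K) h))
  smul_one : ∀ h : H, h • (1 : L) = algebraMap K L (Coalgebra.counit (R := K) h)
  bijective : Function.Bijective (hopfGaloisMap K H L)

section AssociatedOrder

variable (H : Type*) {S L : Type*} [Ring H] [CommRing S] [AddCommGroup L] [Module S L] [Module H L]

/-- The associated order of `B ⊆ L` in `H`: all `h ∈ H` with `h • x ∈ B` for all `x ∈ B`. -/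
def associatedOrder (B : Submodule S L) : Subring H where
  carrier := {h | ∀ x ∈ B, h • x ∈ B}
  mul_mem' ha hb x hx := by
    rw [mul_smul]
    exact ha _ (hb x hx)
  one_mem' x hx := by rwa [one_smul]
  add_mem' ha hb x hx := by
    rw [add_smul]
    exact B.add_mem (ha x hx) (hb x hx)
  zero_mem' x _ := by
    rw [zero_smul]
    exact B.zero_mem
  neg_mem' ha x hx := by
    rw [neg_smul]
    exact B.neg_mem (ha x hx)

/-- `B` is a module over its associated order, by restriction of the action of `H` on `L`. -/
instance associatedOrderModule (B : Submodule S L) : Module (associatedOrder H B) B where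
  smul a x := ⟨(a : H) • (x : L), a.2 x x.2⟩
  one_smul x := Subtype.ext (one_smul H (x : L))
  mul_smul a b x := Subtype.ext (mul_smul (a : H) (b : H) (x : L))
  smul_zero a := Subtype.ext (smul_zero (a : H))
  smul_add a x y := Subtype.ext (smul_add (a : H) (x : L) (y : L))
  add_smul a b x := Subtype.ext (add_smul (a : H) (b : H) (x : L))
  zero_smul x := Subtype.ext (zero_smul H (x : L))

end AssociatedOrder

/-! Suppose `H x = L`. If `z` in `H'` kills `x`, it kills `H x = L` because the actions commute, so
`z = 0`; as `dim H' = dim L`, the orbit map of `x` is bijective for `H'` too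
(`orbitMap_bijective_of_commute`). Integrally, if `B = 𝔄 x` and `z x ∈ B`, then `z B = 𝔄 (z x) ⊆ B`.
So the associated order in `H'` is exactly `{z | z x ∈ B}`, and `x` generates `B` freely over it. It
remains to see that a nonzero free `B` has rank one (`exists_generator_of_free`), by clearing
denominators. -/

section HopfGalois

variable {K L H H' : Type*} [Field K] [Field L] [Algebra K L]
  [Ring H] [HopfAlgebra K H] [Module H L] [IsScalarTower K H L]
  [Ring H'] [HopfAlgebra K H'] [Module H' L] [IsScalarTower K H' L]

theorem IsHopfGalois.finrank_eq (K H L : Type*) [Field K] [Field L] [Algebra K L]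
    [FiniteDimensional K L] [Ring H] [HopfAlgebra K H] [Module H L] [IsScalarTower K H L]
    [IsHopfGalois K H L] : Module.finrank K H = Module.finrank K L := by
  have h := (LinearEquiv.ofBijective (hopfGaloisMap K H L)
    IsHopfGalois.bijective).finrank_eq
  rw [Module.finrank_tensorProduct, Module.finrank_linearMap] at h
  exact Nat.eq_of_mul_eq_mul_left Module.finrank_pos h

-- Such an `h` gives `1 ⊗ h` in the kernel of `hopfGaloisMap`, and `L` is faithfully flat over `K`.
variable (K) in
theorem IsHopfGalois.eq_zero_of_smul_eq_zero [IsHopfGalois K H L] {h : H}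
    (hz : ∀ x : L, h • x = 0) : h = 0 := by
  have h1 : (1 : L) ⊗ₜ[K] h = 0 := by
    apply (IsHopfGalois.bijective (K := K) (H := H) (L := L)).injective
    ext t
    rw [hopfGaloisMap_tmul_apply, hz, map_zero, mul_zero, LinearMap.zero_apply]
  simpa using (Module.FaithfullyFlat.tensorProduct_mk_injective (A := K) (B := L) H)
    (a₁ := h) (a₂ := 0) (by simpa using h1)

variable (K H) in
/-- The orbit map `h ↦ h • x` of `x : L`. -/
def orbitMap (x : L) : H →ₗ[K] L := (Algebra.lsmul K K L (A := H)).toLinearMap.flip x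

@[simp]
theorem orbitMap_apply (x : L) (h : H) : orbitMap K H x h = h • x := rfl

theorem orbitMap_bijective_of_injective [FiniteDimensional K L] [IsHopfGalois K H L] {x : L}
    (hx : Function.Injective (orbitMap K H x)) : Function.Bijective (orbitMap K H x) := by
  have := IsHopfGalois.finite (K := K) (H := H) (L := L)
  exact ⟨hx, (LinearMap.injective_iff_surjective_of_finrank_eq_finrank
    (IsHopfGalois.finrank_eq K H L)).1 hx⟩

theorem orbitMap_bijective_of_surjective [FiniteDimensional K L] [IsHopfGalois K H L] {x : L}
    (hx : Function.Surjective (orbitMap K H x)) : Function.Bijective (orbitMap K H x) := by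
  have := IsHopfGalois.finite (K := K) (H := H) (L := L)
  exact ⟨(LinearMap.injective_iff_surjective_of_finrank_eq_finrank
    (IsHopfGalois.finrank_eq K H L)).2 hx, hx⟩

/-- For commuting Hopf-Galois structures, a generator of `L` for one of them is a free generator
for the other. -/
theorem orbitMap_bijective_of_commute [FiniteDimensional K L] [IsHopfGalois K H' L]
    (hcomm : ∀ (h : H) (h' : H') (x : L), h • (h' • x) = h' • (h • x)) {x : L}
    (hx : Function.Surjective (orbitMap K H x)) : Function.Bijective (orbitMap K H' x) := by
  refine orbitMap_bijective_of_injective ((injective_iff_map_eq_zero _).2 fun z hz ↦ ?_)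
  refine IsHopfGalois.eq_zero_of_smul_eq_zero K (L := L) fun y ↦ ?_
  obtain ⟨h, rfl⟩ := hx y
  rw [orbitMap_apply] at hz ⊢
  rw [← hcomm, hz, smul_zero]

end HopfGalois

section AssociatedOrder

variable {H H' S L : Type*} [Ring H] [Ring H'] [CommRing S] [AddCommGroup L] [Module S L]
  [Module H L] [Module H' L] {B : Submodule S L}

theorem coe_associatedOrder_smul (a : associatedOrder H B) (b : B) :
    ((a • b : B) : L) = (a : H) • (b : L) := rfl

theorem mem_associatedOrder_of_commute
    (hcomm : ∀ (h : H) (h' : H') (x : L), h • (h' • x) = h' • (h • x)) {x : L}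
    (hx : ∀ b ∈ B, ∃ a ∈ associatedOrder H B, a • x = b) {z : H'} (hz : z • x ∈ B) :
    z ∈ associatedOrder H' B := by
  intro b hb
  obtain ⟨a, ha, rfl⟩ := hx b hb
  rw [← hcomm]
  exact ha _ hz

theorem free_associatedOrder_of_bijOn {x : L} (hx : x ∈ B)
    (hinj : Function.Injective fun h : H ↦ h • x)
    (hsurj : ∀ b ∈ B, ∃ a ∈ associatedOrder H B, a • x = b) :
    Module.Free (associatedOrder H B) B := by
  refine Module.Free.of_equiv (M := associatedOrder H B)
    (LinearEquiv.ofBijective (LinearMap.toSpanSingleton _ B ⟨x, hx⟩) ⟨fun a b h ↦ ?_, fun b ↦ ?_⟩)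
  · exact Subtype.ext (hinj (congrArg Subtype.val h))
  · obtain ⟨a, ha, h⟩ := hsurj b b.2
    exact ⟨⟨a, ha⟩, Subtype.ext h⟩

end AssociatedOrder

/-! ### Clearing denominators in `L` and in `H` -/

section Denominators

variable {K L : Type*} [Field K] [Field L] [Algebra K L] {R : Subring K}
  {B : Submodule (integralClosure R L) L}

theorem coe_smul_mem_of_mem (r : R) {x : L} (hx : x ∈ B) : (r : K) • x ∈ B := by
  have := B.smul_mem (algebraMap R (integralClosure R L) r) hx
  rwa [algebraMap_smul] at this

variable [FiniteDimensional K L] [IsFractionRing R K]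

theorem exists_coe_smul_mem_of_finset (hB : B ≠ ⊥) (s : Finset L) :
    ∃ r : R, r ≠ 0 ∧ ∀ x ∈ s, (r : K) • x ∈ B := by
  classical
  obtain ⟨b, hb, hb0⟩ := B.exists_mem_ne_zero_of_ne_bot hB
  -- Once `r (x / b)` is integral, `r x = (r (x / b)) b` lies in `B`.
  obtain ⟨r, hr, h⟩ := exists_integral_multiples R K (s.image fun x ↦ x / b)
  refine ⟨r, hr, fun x hx ↦ ?_⟩
  have := B.smul_mem (⟨_, h _ (Finset.mem_image_of_mem _ hx)⟩ : integralClosure R L) hb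
  convert this using 1
  change (r : K) • x = (r • (x / b)) * b
  rw [smul_mul_assoc, div_mul_cancel₀ _ hb0]
  rfl

theorem exists_coe_smul_mem (hB : B ≠ ⊥) (x : L) : ∃ r : R, r ≠ 0 ∧ (r : K) • x ∈ B := by
  obtain ⟨r, hr, h⟩ := exists_coe_smul_mem_of_finset hB {x}
  exact ⟨r, hr, h x (Finset.mem_singleton_self x)⟩

variable [IsIntegrallyClosed R] [Algebra.IsSeparable K L]

/-- By separability the integral closure lies in the `R`-span of a trace-dual basis; dividing by a
denominator `d` of `B` gives the finite set, which need not lie in `B`. -/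
theorem IsFractional.exists_finset_le_span (hB : IsFractional (integralClosure R L)⁰ B) :
    ∃ s : Finset L, ∀ x ∈ B, x ∈ Submodule.span R (s : Set L) := by
  classical
  obtain ⟨d, hd, hdB⟩ := hB
  have hd0 : (d : L) ≠ 0 := fun h ↦ nonZeroDivisors.ne_zero hd (Subtype.ext h)
  obtain ⟨t, v, hv⟩ := FiniteDimensional.exists_is_basis_integral R K L
  have hle := integralClosure_le_span_dualBasis v hv
  set w := (Algebra.traceForm K L).dualBasis (traceForm_nondegenerate K L) v
  refine ⟨Finset.univ.image fun i ↦ (d : L)⁻¹ * w i, fun x hx ↦ ?_⟩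
  obtain ⟨y, hy⟩ := hdB x hx
  have hyw := Submodule.mem_map_of_mem (f := LinearMap.mulLeft R (d : L)⁻¹) (hle y.2)
  rw [Submodule.map_span, ← Set.range_comp] at hyw
  have hxy : x = (d : L)⁻¹ * y := by
    rw [eq_inv_mul_iff_mul_eq₀ hd0]
    exact hy.symm
  rw [hxy]
  simpa [Function.comp_def] using hyw

/-- The action of `h` is `R`-linear, so only its values on a finite spanning set need a common
denominator. -/
theorem exists_coe_smul_mem_associatedOrder {H : Type*} [Ring H] [Algebra K H] [Module H L]
    [IsScalarTower K H L] (hB : IsFractional (integralClosure R L)⁰ B) (hB0 : B ≠ ⊥) (h : H) :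
    ∃ r : R, r ≠ 0 ∧ (r : K) • h ∈ associatedOrder H B := by
  classical
  obtain ⟨s, hs⟩ := IsFractional.exists_finset_le_span hB
  obtain ⟨r, hr, hrs⟩ := exists_coe_smul_mem_of_finset hB0 (s.image fun x ↦ h • x)
  refine ⟨r, hr, fun x hx ↦ ?_⟩
  have hxs := hs x hx
  clear hx
  induction hxs using Submodule.span_induction with
  | mem x hx =>
    rw [smul_assoc]
    exact hrs _ (Finset.mem_image_of_mem _ hx)
  | zero => rw [smul_zero]; exact B.zero_mem
  | add x y _ _ hx hy => rw [smul_add]; exact B.add_mem hx hy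
  | smul c x _ hx =>
    change ((r : K) • h) • ((c : K) • x) ∈ B
    rw [smul_algebra_smul_comm]
    exact coe_smul_mem_of_mem c hx

end Denominators

theorem IsRingOfIntegers.isFractionRing_and_isIntegrallyClosed {K : Type*} [Field K]
    {R : Subring K} (hR : IsRingOfIntegers R) : IsFractionRing R K ∧ IsIntegrallyClosed R := by
  rcases hR with ⟨_, rfl⟩ | ⟨F, _, _, _, _, _, _, rfl⟩ | ⟨_, _, _, rfl⟩
  · exact ⟨inferInstanceAs (IsFractionRing (NumberField.RingOfIntegers K) K),
      inferInstanceAs (IsIntegrallyClosed (NumberField.RingOfIntegers K))⟩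
  · exact ⟨inferInstanceAs (IsFractionRing (FunctionField.ringOfIntegers F K) K),
      inferInstanceAs (IsIntegrallyClosed (FunctionField.ringOfIntegers F K))⟩
  · exact ⟨inferInstanceAs
        (IsFractionRing (ValuativeRel.valuation K).valuationSubring K),
      (Valuation.integer.integers (ValuativeRel.valuation K)).isIntegrallyClosed⟩

/-! ### Free generators of `B` and their transfer between commuting structures -/

section Main

variable {K L H H' : Type*} [Field K] [Field L] [Algebra K L]
  [FiniteDimensional K L]
  [Ring H] [HopfAlgebra K H] [Module H L] [IsScalarTower K H L] [IsHopfGalois K H L]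
  [Ring H'] [HopfAlgebra K H'] [Module H' L] [IsScalarTower K H' L] [IsHopfGalois K H' L]
  {R : Subring K} [IsFractionRing R K] {B : Submodule (integralClosure R L) L}

theorem orbitMap_bijective_of_generates (hB0 : B ≠ ⊥) {x : L}
    (hx : ∀ b ∈ B, ∃ a ∈ associatedOrder H B, a • x = b) :
    Function.Bijective (orbitMap K H x) := by
  refine orbitMap_bijective_of_surjective fun y ↦ ?_
  obtain ⟨r, hr, hry⟩ := exists_coe_smul_mem hB0 y
  obtain ⟨a, -, ha⟩ := hx _ hry
  have hr' : (r : K) ≠ 0 := by simpa using hr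
  refine ⟨(r : K)⁻¹ • a, ?_⟩
  rw [orbitMap_apply, smul_assoc, ha, inv_smul_smul₀ hr']

theorem generates_of_commute
    (hcomm : ∀ (h : H) (h' : H') (x : L), h • (h' • x) = h' • (h • x)) (hB0 : B ≠ ⊥) {x : L}
    (hx : ∀ b ∈ B, ∃ a ∈ associatedOrder H B, a • x = b) :
    ∀ b ∈ B, ∃ z ∈ associatedOrder H' B, z • x = b := by
  intro b hb
  obtain ⟨z, rfl⟩ :=
    (orbitMap_bijective_of_commute hcomm (orbitMap_bijective_of_generates hB0 hx).2).2 b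
  exact ⟨z, mem_associatedOrder_of_commute hcomm hx hb, rfl⟩

variable [IsIntegrallyClosed R] [Algebra.IsSeparable K L]

/-- A non-zero fractional ideal that is free over its associated order is free of rank one. -/
theorem exists_generator_of_free (hB : IsFractional (integralClosure R L)⁰ B) (hB0 : B ≠ ⊥)
    [Module.Free (associatedOrder H B) B] :
    ∃ x ∈ B, ∀ b ∈ B, ∃ a ∈ associatedOrder H B, a • x = b := by
  let v := Module.Free.chooseBasis (associatedOrder H B) B
  have : Nontrivial B := Submodule.nontrivial_iff_ne_bot.2 hB0
  have : Nontrivial H := Module.nontrivial H L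
  -- If `h` kills `v i`, so does a multiple `r h` in the associated order; its `i`-th coordinate
  -- gives `r h = 0`.
  have hbij (i) : Function.Bijective (orbitMap K H (v i : L)) := by
    refine orbitMap_bijective_of_injective ((injective_iff_map_eq_zero _).2 fun h hh ↦ ?_)
    have hh0 : h • (v i : L) = 0 := hh
    obtain ⟨r, hr, hrh⟩ := exists_coe_smul_mem_associatedOrder hB hB0 h
    have hr' : (r : K) ≠ 0 := by simpa using hr
    have h0 : (⟨_, hrh⟩ : associatedOrder H B) • v i = 0 := Subtype.ext <| by
      rw [coe_associatedOrder_smul, smul_assoc, hh0, smul_zero]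
      rfl
    have h1 := congrArg (fun y ↦ v.repr y i) h0
    simp only [map_smul, v.repr_self, map_zero, Finsupp.smul_apply, Finsupp.single_eq_same,
      smul_eq_mul, mul_one, Finsupp.zero_apply] at h1
    exact (smul_eq_zero.1 (congrArg Subtype.val h1)).resolve_left hr'
  obtain ⟨i⟩ := v.index_nonempty
  -- Since `v j = h (v i)` for some `h`, clearing denominators gives `r (v j) = (r h) (v i)`, a
  -- forbidden relation if `j ≠ i`.
  have hsub (j) : j = i := by
    by_contra hji
    obtain ⟨h, hh⟩ := (hbij i).2 (v j)
    obtain ⟨r, hr, hrh⟩ := exists_coe_smul_mem_associatedOrder hB hB0 h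
    have hr' : (r : K) ≠ 0 := by simpa using hr
    have hrm : (r : K) • (1 : H) ∈ associatedOrder H B := fun x hx ↦ by
      rw [smul_assoc, one_smul]
      exact coe_smul_mem_of_mem r hx
    have h0 : (⟨_, hrm⟩ : associatedOrder H B) • v j = (⟨_, hrh⟩ : associatedOrder H B) • v i :=
      Subtype.ext <| by
        rw [coe_associatedOrder_smul, coe_associatedOrder_smul, smul_assoc, smul_assoc, one_smul,
          ← hh, orbitMap_apply]
    have h1 := congrArg (fun y ↦ v.repr y j) h0
    simp only [map_smul, v.repr_self, Finsupp.smul_apply, Finsupp.single_eq_same,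
      Finsupp.single_eq_of_ne hji, smul_eq_mul, mul_one, mul_zero] at h1
    exact smul_ne_zero hr' one_ne_zero (congrArg Subtype.val h1)
  refine ⟨v i, (v i).2, fun b hb ↦ ?_⟩
  have : Unique (Module.Free.ChooseBasisIndex (associatedOrder H B) B) := ⟨⟨i⟩, hsub⟩
  refine ⟨v.repr ⟨b, hb⟩ i, (v.repr ⟨b, hb⟩ i).2, ?_⟩
  rw [← coe_associatedOrder_smul]
  conv_rhs => rw [← show ((⟨b, hb⟩ : B) : L) = b from rfl, ← v.sum_repr ⟨b, hb⟩]
  rw [Fintype.sum_eq_single i fun j hj ↦ (hj (hsub j)).elim]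

theorem free_associatedOrder_of_commute
    (hcomm : ∀ (h : H) (h' : H') (x : L), h • (h' • x) = h' • (h • x))
    (hB : IsFractional (integralClosure R L)⁰ B) (hfree : Module.Free (associatedOrder H B) B) :
    Module.Free (associatedOrder H' B) B := by
  by_cases hB0 : B = ⊥
  · have : Subsingleton B := Submodule.subsingleton_iff_eq_bot.2 hB0
    infer_instance
  obtain ⟨x, hxB, hx⟩ := exists_generator_of_free (H := H) hB hB0
  exact free_associatedOrder_of_bijOn hxB
    (orbitMap_bijective_of_commute hcomm (orbitMap_bijective_of_generates hB0 hx).2).1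
    (generates_of_commute hcomm hB0 hx)

end Main


theorem theorem1p2 {K L H₁ H₂ : Type*} [Field K] [Field L] [Algebra K L]
    [FiniteDimensional K L] [Algebra.IsSeparable K L]
    [Ring H₁] [HopfAlgebra K H₁] [Module H₁ L] [IsScalarTower K H₁ L] [IsHopfGalois K H₁ L]
    [Ring H₂] [HopfAlgebra K H₂] [Module H₂ L] [IsScalarTower K H₂ L] [IsHopfGalois K H₂ L]
    (hcomm : ∀ (h₁ : H₁) (h₂ : H₂) (x : L), h₁ • (h₂ • x) = h₂ • (h₁ • x))
    (R : Subring K) (hR : IsRingOfIntegers R)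
    (𝔅 : FractionalIdeal (integralClosure R L)⁰ L) :
    (Module.Free (associatedOrder H₁ (𝔅 : Submodule (integralClosure R L) L))
        (𝔅 : Submodule (integralClosure R L) L) ↔
      Module.Free (associatedOrder H₂ (𝔅 : Submodule (integralClosure R L) L))
        (𝔅 : Submodule (integralClosure R L) L)) ∧
    ∀ x ∈ 𝔅,
      (∀ b ∈ 𝔅, ∃! a : H₁,
        a ∈ associatedOrder H₁ (𝔅 : Submodule (integralClosure R L) L) ∧ a • x = b) →
      (∀ a ∈ associatedOrder H₁ (𝔅 : Submodule (integralClosure R L) L),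
        ∃! z : H₂, z • x = a • x) ∧
      ∀ z : H₂, z ∈ associatedOrder H₂ (𝔅 : Submodule (integralClosure R L) L) ↔
        ∃ a ∈ associatedOrder H₁ (𝔅 : Submodule (integralClosure R L) L), z • x = a • x := by
  obtain ⟨_, _⟩ := hR.isFractionRing_and_isIntegrallyClosed
  refine ⟨⟨free_associatedOrder_of_commute hcomm 𝔅.isFractional,
    free_associatedOrder_of_commute (fun h h' x ↦ (hcomm h' h x).symm) 𝔅.isFractional⟩,
    fun x hxB hx ↦ ?_⟩
  have hgen : ∀ b ∈ (𝔅 : Submodule (integralClosure R L) L),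
      ∃ a ∈ associatedOrder H₁ (𝔅 : Submodule (integralClosure R L) L), a • x = b :=
    fun b hb ↦ (hx b hb).exists
  -- If `𝔅 = 0`, its associated order is all of `H₁`, and `0 = 0 • x = 1 • x` contradicts
  -- uniqueness.
  have hB0 : (𝔅 : Submodule (integralClosure R L) L) ≠ ⊥ := by
    intro h0
    have : Nontrivial H₁ := Module.nontrivial H₁ L
    have hall (a : H₁) : a ∈ associatedOrder H₁ (𝔅 : Submodule (integralClosure R L) L) ∧
        a • x = 0 := by
      have hx0 : x = 0 := by
        rw [← FractionalIdeal.mem_coe, h0] at hxB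
        exact hxB
      refine ⟨fun y hy ↦ ?_, by rw [hx0, smul_zero]⟩
      rw [h0, Submodule.mem_bot] at hy ⊢
      rw [hy, smul_zero]
    exact one_ne_zero ((hx 0 (Submodule.zero_mem _)).unique (hall 1) (hall 0))
  have hbij := orbitMap_bijective_of_commute hcomm (orbitMap_bijective_of_generates hB0 hgen).2
  refine ⟨fun a _ ↦ hbij.existsUnique _, fun z ↦ ⟨fun hz ↦ ?_, ?_⟩⟩
  · obtain ⟨a, ha, h⟩ := hgen _ (hz x hxB)
    exact ⟨a, ha, h.symm⟩
  · rintro ⟨a, ha, h⟩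
    exact mem_associatedOrder_of_commute hcomm hgen (h ▸ ha x hxB)
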